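/- Let $T>0$, $N\in\mathbb N$, and let $A_\epsilon(t)=A_0+\epsilon A_1(t)+\epsilon^2A_2(t)+\dots\in\mathbb C^{N\times N}$ be a family of matrix functions such that $A_0$ is constant and diagonal, each $A_n$ ($n\ge1$) is a finite sum $A_n(t)=\sum_{m}e^{2\pi i mt/T}A_n^m$ with constant matrices $A_n^m$, and for some $r_0>0$ the series converges for all $|\epsilon|<r_0$, uniformly in $t\in\mathbb R$. Let $$X_\epsilon(t)=P_\epsilon(t)\exp(F_\epsilon t),\qquad P_\epsilon(t)=\sum_{n\ge0}\epsilon^nP_n(t),\qquad F_\epsilon=\sum_{n\ge0}\epsilon^nF_n ,$$ for small real $\epsilon$, be a Floquet–Lyapunov decomposition, depending analytically on $\epsilon$ near $0$, of the fundamental solution $X_\epsilon$ of $dx/dt=A_\epsilon(t)x$, $X_\epsilon(0)=\mathrm{Id}$, with $P_\epsilon$ $T$-periodic. Assume that $F_0$ is the diagonal matrix with $(F_0)_{kk}\equiv(A_0)_{kk}$ modulo $\frac{2\pi i}{T}\mathbb Z$ and $\operatorname{Im}(F_0)_{kk}\in(-\pi/T,\pi/T]$ for all $k$, and put $n_k=\frac{T}{2\pi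 i}(A_0-F_0)_{kk}\in\mathbb Z$. Write $B^m=\frac1T\int_0^Te^{-2\pi imt/T}B(t)\,dt$ for the Fourier coefficients of a $T$-periodic matrix function $B$. Then for all $k,l$ with $(F_0)_{kk}=(F_0)_{ll}$, $$(F_2)_{kl}=\Bigl(\sum_{m\in\mathbb Z}A_1^{n_k-m}P_1^m\Bigr)_{kl}-\bigl(P_1^{n_k}F_1\bigr)_{kl}+\Bigl(\sum_{m\in\mathbb Z}A_2^{n_k-m}P_0^m\Bigr)_{kl},$$ where $$\Bigl(\sum_{m\in\mathbb Z}A_1^{n_k-m}P_1^m\Bigr)_{kl}=\sum_{j=1}^N\ \sum_{m\ne n_j-n_l}\frac{(A_1^{n_k-n_l-m}-A_1^{n_k-n_j})_{kj}(A_1^m)_{jl}}{\frac{2\pi i}{T}m+(A_0)_{ll}-(A_0)_{jj}},$$ $$\bigl(P_1^{n_k}F_1\bigr)_{kl}=-\sum_{j=1}^N\ \sum_{m\ne n_k-n_j}\frac{(A_1^m)_{kj}(F_1)_{jl}}{\frac{2\pi i}{T}m+(A_0)_{jj}-(A_0)_{kk}},\qquad \Bigl(\sum_{m\in\mathbb Z}A_2^{n_k-m}P_0^m\Bigr)_{kl}=(A_2^{n_k-n_l})_{kl},$$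 so that $$(F_2)_{kl}=\sum_{j=1}^N\sum_{m\ne n_j-n_l}\frac{(A_1^{n_k-n_l-m}-A_1^{n_k-n_j})_{kj}(A_1^m)_{jl}}{\frac{2\pi i}{T}m+(A_0)_{ll}-(A_0)_{jj}}+\sum_{j=1}^N\sum_{m\ne n_k-n_j}\frac{(A_1^m)_{kj}(F_1)_{jl}}{\frac{2\pi i}{T}m+(A_0)_{jj}-(A_0)_{kk}}+(A_2^{n_k-n_l})_{kl}.$$ Moreover, in terms of $A_0,A_1,F_0$ only, $\bigl(P_1^{n_k}F_1\bigr)_{kl}=-\sum_{j=1}^Nc_j$, where $$c_j=\sum_{m\ne n_k-n_j}\frac{(A_1^m)_{kj}(A_1^{n_j-n_l})_{jl}}{\frac{2\pi i}{T}m+(A_0)_{jj}-(A_0)_{kk}}\quad\text{if }(F_0)_{jj}=(F_0)_{ll},$$ $$c_j=\bigl((F_0)_{ll}-(F_0)_{jj}\bigr)\Bigl(\sum_{m\ne n_k-n_j}\frac{(A_1^m)_{kj}}{\frac{2\pi i}{T}m+(A_0)_{jj}-(A_0)_{kk}}\Bigr)\Bigl(\sum_{m\in\mathbb Z}\frac{(A_1^m)_{jl}}{\frac{2\pi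 i}{T}m+(A_0)_{ll}-(A_0)_{jj}}\Bigr)\quad\text{if }(F_0)_{jj}\ne(F_0)_{ll}.$$ Here $m$ ranges over $\mathbb Z$, and all sums have only finitely many nonzero terms. -/

import Mathlib

noncomputable section

namespace Floquet

/-- `2 π i / T`. -/
def freq (T : ℝ) : ℂ := 2 * (Real.pi : ℂ) * Complex.I / (T : ℂ)

/-- The Fourier mode `t ↦ exp ((2 π i / T) m t)`. -/
def mode (T : ℝ) (m : ℤ) (t : ℝ) : ℂ := Complex.exp (freq T * (m : ℂ) * (t : ℂ))

/-- `B` is a finite sum `∑ exp ((2 π i / T) m t) b_m` with constant matrices `b_m`. -/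
def HasFiniteFourierSeries {N : ℕ} (T : ℝ) (B : ℝ → Matrix (Fin N) (Fin N) ℂ) : Prop :=
  ∃ (S : Finset ℤ) (b : ℤ → Matrix (Fin N) (Fin N) ℂ), ∀ t : ℝ, B t = ∑ m ∈ S, mode T m t • b m

/-- The `m`-th Fourier coefficient `B^m` of a `T`-periodic matrix function `B`, taken entrywise. -/
def fourierMat {N : ℕ} (T : ℝ) (B : ℝ → Matrix (Fin N) (Fin N) ℂ) (m : ℤ) :
    Matrix (Fin N) (Fin N) ℂ :=
  Matrix.of fun k l => (1 / (T : ℂ)) * ∫ t in (0 : ℝ)..T, mode T (-m) t * B t k l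

/-- `X` is the fundamental solution of `dx/dt = A(t) x`, normalised at time `0`. -/
structure IsFundamentalSolution {N : ℕ} (A X : ℝ → Matrix (Fin N) (Fin N) ℂ) : Prop where
  init : X 0 = 1
  deriv : ∀ (t : ℝ) (k l : Fin N), HasDerivAt (fun s => X s k l) ((A t * X t) k l) t

/-- `X(t) = P(t) exp (F t)` with `P` `T`-periodic, `X` being the fundamental solution. -/
structure IsFloquetDecomposition {N : ℕ} (T : ℝ) (A P : ℝ → Matrix (Fin N) (Fin N) ℂ)
    (F : Matrix (Fin N) (Fin N) ℂ) : Prop where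
  periodic : Function.Periodic P T
  fundamental : IsFundamentalSolution A (fun t => P t * NormedSpace.exp ((t : ℂ) • F))

/-- The family `A_ε(t) = A₀ + ε A₁(t) + ε² A₂(t) + …`: the leading term is constant and diagonal,
every other coefficient has a finite Fourier series of period `T`, and for `|ε| < r₀` the series
converges uniformly in `t`.  Continuity and `T`-periodicity of `A_ε` are consequences. -/
structure IsModulatedFamily {N : ℕ} (T r₀ : ℝ) (A₀ : Matrix (Fin N) (Fin N) ℂ)
    (A : ℕ → ℝ → Matrix (Fin N) (Fin N) ℂ) (Aeps : ℝ → ℝ → Matrix (Fin N) (Fin N) ℂ) : Prop where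
  diag : A₀.IsDiag
  const : ∀ t : ℝ, A 0 t = A₀
  finite : ∀ n : ℕ, 1 ≤ n → HasFiniteFourierSeries T (A n)
  series : ∀ ε : ℝ, |ε| < r₀ →
    TendstoUniformly (fun (M : ℕ) (t : ℝ) => ∑ n ∈ Finset.range M, ((ε : ℂ) ^ n) • A n t)
      (Aeps ε) Filter.atTop

/-- `F₀` is the diagonal matrix congruent to `A₀` modulo `diag ((2 π i / T) ℤ, …)` whose diagonal
entries have imaginary part in `(-π / T, π / T]`; `n k` are the folding numbers. -/
structure IsLeadingExponent {N : ℕ} (T : ℝ) (A₀ F₀ : Matrix (Fin N) (Fin N) ℂ)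
    (n : Fin N → ℤ) : Prop where
  diag : F₀.IsDiag
  fold : ∀ k, (A₀ - F₀) k k = freq T * (n k : ℂ)
  im_mem : ∀ k, (F₀ k k).im ∈ Set.Ioc (-(Real.pi / T)) (Real.pi / T)

/-- `F` and `P` are the Taylor coefficients in `ε` of an analytically dependent Floquet-Lyapunov
decomposition of `dx/dt = A_ε(t) x` near `ε = 0`. -/
def IsAnalyticFloquetDecomposition {N : ℕ} (T : ℝ) (Aeps : ℝ → ℝ → Matrix (Fin N) (Fin N) ℂ)
    (F : ℕ → Matrix (Fin N) (Fin N) ℂ) (P : ℕ → ℝ → Matrix (Fin N) (Fin N) ℂ) : Prop :=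
  ∃ (r : ℝ) (Feps : ℝ → Matrix (Fin N) (Fin N) ℂ) (Peps : ℝ → ℝ → Matrix (Fin N) (Fin N) ℂ),
    0 < r ∧ ∀ ε : ℝ, |ε| < r →
      HasSum (fun i : ℕ => ((ε : ℂ) ^ i) • F i) (Feps ε) ∧
      (∀ t : ℝ, HasSum (fun i : ℕ => ((ε : ℂ) ^ i) • P i t) (Peps ε t)) ∧
      IsFloquetDecomposition T (Aeps ε) (Peps ε) (Feps ε)

end Floquet

end

/-! Since `Peps = X exp(-tF)`, the periodic factor solves `P' = A P - P F` with `P(0) = 1`.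
Comparing powers of `ε` gives linear equations for the Taylor coefficients. The series for `P` is
only assumed to converge pointwise in `t`, so it cannot be differentiated termwise. Instead the
order equations are solved by functions `Q₀, Q₁, Q₂`, Grönwall's inequality shows that their Taylor
polynomial is `O(ε³)`-close to `Peps`, and uniqueness of Taylor coefficients gives `P i = Q i` on
`[0, T]` (`taylor_two_error_le`, `taylor_two_unique`, `exists_order_equations`).

Taking Fourier coefficients turns the equations into algebra (`first_order_relations`). At order
zero, `P₀ = diag(mode (n k))`. At order one, each coefficient of entry `(j,l)` of `P₁` is an entry
of `A₁` over a denominator, except at the index `n j`, where `F₁` enters and the denominator may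
vanish. That coefficient is recovered from `P₁(0) = 0`, which says that the coefficients sum to
zero; this produces the differences in the numerators (`tsum_mul_of_tsum_eq_zero`). At order two, in
coefficient `n k` of entry `(k,l)`, the unknown `P₂` is multiplied by `(F₀)_ll - (F₀)_kk = 0`, so
the equation gives `F₂`. -/

namespace Floquet

open Filter Topology Set

/-! ### Second-order Taylor polynomials: remainder and uniqueness -/

section Taylor

variable {E : Type*} [NormedAddCommGroup E] [NormedSpace ℂ E]

theorem norm_ofReal_pow (x : ℝ) (i : ℕ) : ‖(x : ℂ) ^ i‖ = |x| ^ i := by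
  rw [norm_pow, Complex.norm_real, Real.norm_eq_abs]

/-- Convergence at the single point `ρ` suffices: the terms tend to zero, hence are bounded. -/
theorem exists_coeff_bound {ρ : ℝ} (hρ : 0 < ρ) {a : ℕ → E} {s : E}
    (h : HasSum (fun i : ℕ => ((ρ : ℂ) ^ i) • a i) s) :
    ∃ C, ∀ i, ‖a i‖ ≤ C / ρ ^ i := by
  obtain ⟨C, hC⟩ := (h.summable.tendsto_atTop_zero.norm).bddAbove_range
  refine ⟨C, fun i => ?_⟩
  have := hC ⟨i, rfl⟩
  rw [le_div_iff₀ (by positivity)]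
  simp only [norm_smul, norm_ofReal_pow, abs_of_pos hρ] at this
  linarith

theorem norm_taylor_term_le {ρ C ε : ℝ} {a : ℕ → E}
    (ha : ∀ i, ‖a i‖ ≤ C / ρ ^ i) (i : ℕ) :
    ‖((ε : ℂ) ^ i) • a i‖ ≤ C * (|ε| / ρ) ^ i := by
  rw [norm_smul, norm_ofReal_pow, div_pow, mul_div_assoc', mul_comm C, mul_div_assoc]
  exact mul_le_mul_of_nonneg_left (ha i) (by positivity)

/-- The tail is dominated by a geometric series of ratio `|ε| / ρ ≤ 1/2`, whose sum costs the factor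
2. -/
theorem norm_sub_taylor_two_le {ρ C ε : ℝ} (hρ : 0 < ρ) {a : ℕ → E} {s : E}
    (ha : ∀ i, ‖a i‖ ≤ C / ρ ^ i) (hε : |ε| ≤ ρ / 2)
    (h : HasSum (fun i : ℕ => ((ε : ℂ) ^ i) • a i) s) :
    ‖s - (a 0 + (ε : ℂ) • a 1 + (ε : ℂ) ^ 2 • a 2)‖ ≤ 2 * C / ρ ^ 3 * |ε| ^ 3 := by
  have h3 := (hasSum_nat_add_iff' 3).2 h
  have hC : 0 ≤ C := by simpa using (norm_nonneg _).trans (ha 0)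
  have hq0 : 0 ≤ |ε| / ρ := by positivity
  have hq : |ε| / ρ ≤ 1 / 2 := by rw [div_le_iff₀ hρ]; linarith
  have hg : HasSum (fun i : ℕ => C * (|ε| / ρ) ^ 3 * (|ε| / ρ) ^ i)
      (C * (|ε| / ρ) ^ 3 * (1 - |ε| / ρ)⁻¹) :=
    (hasSum_geometric_of_lt_one hq0 (by linarith)).mul_left _
  have hb : ∀ i : ℕ, ‖((ε : ℂ) ^ (i + 3)) • a (i + 3)‖ ≤ C * (|ε| / ρ) ^ 3 * (|ε| / ρ) ^ i := by
    intro i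
    refine (norm_taylor_term_le ha (i + 3)).trans (le_of_eq ?_)
    ring
  have hle := h3.norm_le_of_bounded hg hb
  simp only [Finset.sum_range_succ, Finset.sum_range_zero, zero_add, pow_zero, one_smul,
    pow_one] at hle
  refine hle.trans ?_
  have hi : (1 - |ε| / ρ)⁻¹ ≤ 2 := by
    rw [inv_le_comm₀ (by linarith) (by norm_num)]; linarith
  calc _ ≤ C * (|ε| / ρ) ^ 3 * 2 := mul_le_mul_of_nonneg_left hi (by positivity)
    _ = _ := by rw [div_pow]; ring

theorem eq_zero_of_norm_add_smul_le {C δ : ℝ} (hδ : 0 < δ) {a : E} {b : ℝ → E} {M : ℝ}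
    (hb : ∀ ε : ℝ, |ε| < δ → ‖b ε‖ ≤ M)
    (h : ∀ ε : ℝ, 0 < ε → ε < δ → ‖a + (ε : ℂ) • b ε‖ ≤ C * ε) : a = 0 := by
  by_contra hne
  have hpos : 0 < ‖a‖ := norm_pos_iff.2 hne
  have hle : ∀ ε : ℝ, 0 < ε → ε < δ → ‖a‖ ≤ (|C| + |M|) * ε := by
    intro ε h0 h1
    have h2 := h ε h0 h1
    have h3 := hb ε (by rwa [abs_of_pos h0])
    have h4 : ‖a‖ ≤ ‖a + (ε : ℂ) • b ε‖ + ‖(ε : ℂ) • b ε‖ := by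
      simpa using norm_sub_le (a + (ε : ℂ) • b ε) ((ε : ℂ) • b ε)
    rw [norm_smul, Complex.norm_real, Real.norm_eq_abs, abs_of_pos h0] at h4
    have h5 : ε * ‖b ε‖ ≤ ε * |M| := mul_le_mul_of_nonneg_left (h3.trans (le_abs_self _)) h0.le
    have h6 : C * ε ≤ |C| * ε := mul_le_mul_of_nonneg_right (le_abs_self _) h0.le
    linarith
  have ht : Tendsto (fun ε : ℝ => (|C| + |M|) * ε) (𝓝[>] 0) (𝓝 0) := by
    have : Tendsto (fun ε : ℝ => (|C| + |M|) * ε) (𝓝 0) (𝓝 ((|C| + |M|) * 0)) :=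
      (continuous_const.mul continuous_id).tendsto 0
    rw [mul_zero] at this
    exact this.mono_left nhdsWithin_le_nhds
  have := ge_of_tendsto ht (by
    filter_upwards [Ioo_mem_nhdsGT hδ] with ε hε using hle ε hε.1 hε.2)
  linarith

/-- The coefficients are peeled off one at a time: let `ε → 0+`, conclude that the leading one
vanishes, divide by `ε`, repeat. -/
theorem taylor_two_unique {C δ : ℝ} (hδ : 0 < δ) {a b c : E}
    (h : ∀ ε : ℝ, |ε| < δ → ‖a + (ε : ℂ) • b + (ε : ℂ) ^ 2 • c‖ ≤ C * |ε| ^ 3) :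
    a = 0 ∧ b = 0 ∧ c = 0 := by
  have key : ∀ ε : ℝ, 0 < ε → ε < min δ 1 →
      ‖a + (ε : ℂ) • b + (ε : ℂ) ^ 2 • c‖ ≤ |C| * ε ^ 3 ∧ ε ^ 3 ≤ ε ^ 2 ∧ ε ^ 2 ≤ ε := by
    intro ε h0 h1
    have h2 := h ε (by rw [abs_of_pos h0]; exact h1.trans_le (min_le_left _ _))
    have h3 : ε < 1 := h1.trans_le (min_le_right _ _)
    rw [abs_of_pos h0] at h2
    refine ⟨h2.trans (mul_le_mul_of_nonneg_right (le_abs_self _) (by positivity)), ?_, ?_⟩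
    · nlinarith [sq_nonneg ε]
    · nlinarith
  have hm : 0 < min δ 1 := lt_min hδ one_pos
  have ha : a = 0 := by
    refine eq_zero_of_norm_add_smul_le (C := |C|) hm (b := fun ε => b + (ε : ℂ) • c)
      (M := ‖b‖ + ‖c‖) ?_ ?_
    · intro ε hε
      refine (norm_add_le _ _).trans ?_
      rw [norm_smul, Complex.norm_real, Real.norm_eq_abs]
      have : |ε| ≤ 1 := (hε.trans_le (min_le_right _ _)).le
      nlinarith [norm_nonneg c]
    · intro ε h0 h1
      obtain ⟨h2, h3, h4⟩ := key ε h0 h1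
      have : a + (ε : ℂ) • (b + (ε : ℂ) • c) = a + (ε : ℂ) • b + (ε : ℂ) ^ 2 • c := by module
      rw [this]
      exact h2.trans (mul_le_mul_of_nonneg_left (h3.trans h4) (abs_nonneg _))
  subst ha
  have hb : b = 0 := by
    refine eq_zero_of_norm_add_smul_le (C := |C|) hm (b := fun _ => c) (M := ‖c‖)
      (fun _ _ => le_rfl) ?_
    intro ε h0 h1
    obtain ⟨h2, h3, h4⟩ := key ε h0 h1
    have : (0 : E) + (ε : ℂ) • b + (ε : ℂ) ^ 2 • c = (ε : ℂ) • (b + (ε : ℂ) • c) := by module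
    rw [this, norm_smul, Complex.norm_real, Real.norm_eq_abs, abs_of_pos h0] at h2
    have h5 : ε * ‖b + (ε : ℂ) • c‖ ≤ ε * (|C| * ε ^ 2) := by linarith [h2]
    exact (le_of_mul_le_mul_left h5 h0).trans (mul_le_mul_of_nonneg_left h4 (abs_nonneg _))
  subst hb
  refine ⟨rfl, rfl, ?_⟩
  refine eq_zero_of_norm_add_smul_le (C := |C|) hm (b := fun _ => 0) (M := 0)
    (fun _ _ => by simp) ?_
  intro ε h0 h1
  obtain ⟨h2, -, -⟩ := key ε h0 h1
  have : (0 : E) + (ε : ℂ) • (0 : E) + (ε : ℂ) ^ 2 • c = (ε : ℂ) ^ 2 • c := by module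
  rw [this, norm_smul, norm_ofReal_pow, abs_of_pos h0] at h2
  have h5 : ε ^ 2 * ‖c‖ ≤ ε ^ 2 * (|C| * ε) := by linarith [h2]
  simpa using le_of_mul_le_mul_left h5 (by positivity)

end Taylor

/-! ### Grönwall comparison of the exact solution with its formal expansion -/

section Gronwall

variable {𝔸 : Type*} [NormedRing 𝔸] [NormedAlgebra ℂ 𝔸]

theorem norm_taylor_two_le {ε M : ℝ} (hε : |ε| ≤ 1) {a b c : 𝔸}
    (ha : ‖a‖ ≤ M) (hb : ‖b‖ ≤ M) (hc : ‖c‖ ≤ M) :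
    ‖a + (ε : ℂ) • b + (ε : ℂ) ^ 2 • c‖ ≤ 3 * M := by
  have h1 : ‖(ε : ℂ) • b‖ ≤ M := by
    rw [norm_smul, Complex.norm_real, Real.norm_eq_abs]
    nlinarith [norm_nonneg b, abs_nonneg ε]
  have h2 : ‖(ε : ℂ) ^ 2 • c‖ ≤ M := by
    rw [norm_smul, norm_ofReal_pow]
    nlinarith [norm_nonneg c, pow_le_one₀ (n := 2) (abs_nonneg ε) hε, sq_nonneg |ε|]
  linarith [norm_add₃_le (a := a) (b := (ε : ℂ) • b) (c := (ε : ℂ) ^ 2 • c)]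

theorem norm_taylor_remainder_le {ε M : ℝ} (hε : |ε| ≤ 1)
    {a₁ a₂ q₁ q₂ f₁ f₂ : 𝔸} (ha₁ : ‖a₁‖ ≤ M) (ha₂ : ‖a₂‖ ≤ M) (hq₁ : ‖q₁‖ ≤ M)
    (hq₂ : ‖q₂‖ ≤ M) (hf₁ : ‖f₁‖ ≤ M) (hf₂ : ‖f₂‖ ≤ M) :
    ‖(ε : ℂ) ^ 3 • (a₁ * q₂ + a₂ * q₁ + (ε : ℂ) • (a₂ * q₂)
      - (q₁ * f₂ + q₂ * f₁ + (ε : ℂ) • (q₂ * f₂)))‖ ≤ 6 * M ^ 2 * |ε| ^ 3 := by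
  have hM : 0 ≤ M := (norm_nonneg _).trans ha₁
  have hm : ∀ x y : 𝔸, ‖x‖ ≤ M → ‖y‖ ≤ M → ‖x * y‖ ≤ M ^ 2 := fun x y hx hy =>
    (norm_mul_le x y).trans (by nlinarith [norm_nonneg x, norm_nonneg y])
  have hs : ∀ x : 𝔸, ‖x‖ ≤ M ^ 2 → ‖(ε : ℂ) • x‖ ≤ M ^ 2 := by
    intro x hx
    rw [norm_smul, Complex.norm_real, Real.norm_eq_abs]
    nlinarith [norm_nonneg x, abs_nonneg ε]
  rw [norm_smul, norm_ofReal_pow, mul_comm]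
  refine mul_le_mul_of_nonneg_right ?_ (by positivity)
  refine (norm_sub_le _ _).trans ?_
  linarith [norm_add₃_le (a := a₁ * q₂) (b := a₂ * q₁) (c := (ε : ℂ) • (a₂ * q₂)),
    norm_add₃_le (a := q₁ * f₂) (b := q₂ * f₁) (c := (ε : ℂ) • (q₂ * f₂)),
    hm _ _ ha₁ hq₂, hm _ _ ha₂ hq₁, hs _ (hm _ _ ha₂ hq₂), hm _ _ hq₁ hf₂, hm _ _ hq₂ hf₁,
    hs _ (hm _ _ hq₂ hf₂)]

/-- The difference `R = Peps - q` vanishes at time 0 and solves the same linear equation with a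
forcing of size `O(ε³)`, so Grönwall keeps it `O(ε³)` uniformly on `[0, T]`. Nothing is assumed
about the expansion of `Peps` itself. -/
theorem taylor_two_error_le {T C M δ : ℝ}
    {A Q : ℕ → ℝ → 𝔸} {F : ℕ → 𝔸} {Aeps Peps : ℝ → ℝ → 𝔸} {Feps : ℝ → 𝔸}
    (hAM : ∀ i ≤ 2, ∀ t ∈ Icc 0 T, ‖A i t‖ ≤ M) (hQM : ∀ i ≤ 2, ∀ t ∈ Icc 0 T, ‖Q i t‖ ≤ M)
    (hFM : ∀ i ≤ 2, ‖F i‖ ≤ M)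
    (hA : ∀ ε : ℝ, |ε| < δ → ∀ t ∈ Icc 0 T,
      ‖Aeps ε t - (A 0 t + (ε : ℂ) • A 1 t + (ε : ℂ) ^ 2 • A 2 t)‖ ≤ C * |ε| ^ 3)
    (hF : ∀ ε : ℝ, |ε| < δ → ‖Feps ε - (F 0 + (ε : ℂ) • F 1 + (ε : ℂ) ^ 2 • F 2)‖ ≤ C * |ε| ^ 3)
    (hP : ∀ ε : ℝ, |ε| < δ → ∀ t,
      HasDerivAt (Peps ε) (Aeps ε t * Peps ε t - Peps ε t * Feps ε) t)
    (hP0 : ∀ ε : ℝ, |ε| < δ → Peps ε 0 = 1)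
    (hQ0 : ∀ t, HasDerivAt (Q 0) (A 0 t * Q 0 t - Q 0 t * F 0) t)
    (hQ1 : ∀ t, HasDerivAt (Q 1)
      (A 0 t * Q 1 t + A 1 t * Q 0 t - Q 0 t * F 1 - Q 1 t * F 0) t)
    (hQ2 : ∀ t, HasDerivAt (Q 2) (A 0 t * Q 2 t + A 1 t * Q 1 t + A 2 t * Q 0 t
      - Q 0 t * F 2 - Q 1 t * F 1 - Q 2 t * F 0) t)
    (hQ00 : Q 0 0 = 1) (hQ10 : Q 1 0 = 0) (hQ20 : Q 2 0 = 0) :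
    ∃ C', ∀ ε : ℝ, |ε| < min δ 1 → ∀ t ∈ Icc 0 T,
      ‖Peps ε t - (Q 0 t + (ε : ℂ) • Q 1 t + (ε : ℂ) ^ 2 • Q 2 t)‖ ≤ C' * |ε| ^ 3 := by
  have hM0 : 0 ≤ M := (norm_nonneg _).trans (hFM 0 (by norm_num))
  -- `3 * M + |C|` bounds both `Aeps` and `Feps`; the extra 1 makes `K` nonzero, as the closed form
  -- of the Grönwall bound requires.
  set K : ℝ := 2 * (3 * M + |C|) + 1 with hK
  have hKpos : 0 < K := by positivity
  -- The first summand covers the truncation errors of `Aeps` and `Feps` multiplied by `q`, the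
  -- second the six products in `rem`.
  set D : ℝ := 6 * M * |C| + 6 * M ^ 2 with hD
  refine ⟨D / K * (Real.exp (K * T) - 1), fun ε hε => ?_⟩
  have hεδ : |ε| < δ := hε.trans_le (min_le_left _ _)
  have hε1 : |ε| ≤ 1 := (hε.trans_le (min_le_right _ _)).le
  have hε3 : |ε| ^ 3 ≤ 1 := pow_le_one₀ (abs_nonneg _) hε1
  set q : ℝ → 𝔸 := fun t => Q 0 t + (ε : ℂ) • Q 1 t + (ε : ℂ) ^ 2 • Q 2 t with hq
  set a : ℝ → 𝔸 := fun t => A 0 t + (ε : ℂ) • A 1 t + (ε : ℂ) ^ 2 • A 2 t with ha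
  set f : 𝔸 := F 0 + (ε : ℂ) • F 1 + (ε : ℂ) ^ 2 • F 2 with hf
  set rem : ℝ → 𝔸 := fun t => (ε : ℂ) ^ 3 • (A 1 t * Q 2 t + A 2 t * Q 1 t
      + (ε : ℂ) • (A 2 t * Q 2 t)
      - (Q 1 t * F 2 + Q 2 t * F 1 + (ε : ℂ) • (Q 2 t * F 2))) with hrem
  have hCC : C * |ε| ^ 3 ≤ |C| * |ε| ^ 3 :=
    mul_le_mul_of_nonneg_right (le_abs_self _) (by positivity)
  -- The order equations cancel the powers of `ε` up to the second; the products of order `ε³` and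
  -- `ε⁴` are collected in `rem`.
  have hqd : ∀ t, HasDerivAt q (a t * q t - q t * f - rem t) t := by
    intro t
    have h := ((hQ0 t).add ((hQ1 t).const_smul (ε : ℂ))).add ((hQ2 t).const_smul ((ε : ℂ) ^ 2))
    convert! h using 1
    simp only [hq, ha, hf, hrem, mul_add, add_mul, smul_mul_assoc, mul_smul_comm]
    module
  have hRd : ∀ t, HasDerivAt (fun t => Peps ε t - q t)
      (Aeps ε t * (Peps ε t - q t) - (Peps ε t - q t) * Feps ε
        + ((Aeps ε t - a t) * q t - q t * (Feps ε - f) + rem t)) t := by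
    intro t
    convert! (hP ε hεδ t).sub (hqd t) using 1
    noncomm_ring
  have hbound : ∀ t ∈ Ico 0 T,
      ‖Aeps ε t * (Peps ε t - q t) - (Peps ε t - q t) * Feps ε
        + ((Aeps ε t - a t) * q t - q t * (Feps ε - f) + rem t)‖
      ≤ K * ‖Peps ε t - q t‖ + D * |ε| ^ 3 := by
    intro t ht
    have ht' : t ∈ Icc 0 T := ⟨ht.1, ht.2.le⟩
    have h1 := (hA ε hεδ t ht').trans hCC
    have h2 := (hF ε hεδ).trans hCC
    have ha3 : ‖a t‖ ≤ 3 * M := norm_taylor_two_le hε1 (hAM 0 (by norm_num) t ht')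
      (hAM 1 (by norm_num) t ht') (hAM 2 (by norm_num) t ht')
    have hq3 : ‖q t‖ ≤ 3 * M := norm_taylor_two_le hε1 (hQM 0 (by norm_num) t ht')
      (hQM 1 (by norm_num) t ht') (hQM 2 (by norm_num) t ht')
    have hf3 : ‖f‖ ≤ 3 * M := norm_taylor_two_le hε1 (hFM 0 (by norm_num))
      (hFM 1 (by norm_num)) (hFM 2 (by norm_num))
    have hr := norm_taylor_remainder_le hε1 (hAM 1 (by norm_num) t ht')
      (hAM 2 (by norm_num) t ht') (hQM 1 (by norm_num) t ht') (hQM 2 (by norm_num) t ht')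
      (hFM 1 (by norm_num)) (hFM 2 (by norm_num))
    have hC1 : |C| * |ε| ^ 3 ≤ |C| := mul_le_of_le_one_right (abs_nonneg _) hε3
    have hAe : ‖Aeps ε t‖ ≤ 3 * M + |C| := by
      have := norm_add_le (a t) (Aeps ε t - a t)
      rw [add_sub_cancel] at this
      linarith
    have hFe : ‖Feps ε‖ ≤ 3 * M + |C| := by
      have := norm_add_le f (Feps ε - f)
      rw [add_sub_cancel] at this
      linarith
    set R := Peps ε t - q t
    have e1 : ‖Aeps ε t * R‖ ≤ (3 * M + |C|) * ‖R‖ :=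
      (norm_mul_le _ _).trans (mul_le_mul_of_nonneg_right hAe (norm_nonneg _))
    have e2 : ‖R * Feps ε‖ ≤ (3 * M + |C|) * ‖R‖ :=
      (norm_mul_le _ _).trans (by
        rw [mul_comm]; exact mul_le_mul_of_nonneg_right hFe (norm_nonneg _))
    have e3 : ‖(Aeps ε t - a t) * q t‖ ≤ |C| * |ε| ^ 3 * (3 * M) :=
      (norm_mul_le _ _).trans (mul_le_mul h1 hq3 (norm_nonneg _) (by positivity))
    have e4 : ‖q t * (Feps ε - f)‖ ≤ 3 * M * (|C| * |ε| ^ 3) :=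
      (norm_mul_le _ _).trans (mul_le_mul hq3 h2 (norm_nonneg _) (by positivity))
    have n1 := norm_add_le (Aeps ε t * R - R * Feps ε)
      ((Aeps ε t - a t) * q t - q t * (Feps ε - f) + rem t)
    have n2 := norm_sub_le (Aeps ε t * R) (R * Feps ε)
    have n3 := norm_add_le ((Aeps ε t - a t) * q t - q t * (Feps ε - f)) (rem t)
    have n4 := norm_sub_le ((Aeps ε t - a t) * q t) (q t * (Feps ε - f))
    have : D * |ε| ^ 3 = 6 * M * |C| * |ε| ^ 3 + 6 * M ^ 2 * |ε| ^ 3 := by rw [hD]; ring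
    have : K * ‖R‖ = 2 * (3 * M + |C|) * ‖R‖ + ‖R‖ := by rw [hK]; ring
    linarith [norm_nonneg R]
  have hmain := norm_le_gronwallBound_of_norm_deriv_right_le (δ := 0) (K := K) (ε := D * |ε| ^ 3)
    (f := fun t => Peps ε t - q t) (a := 0) (b := T)
    (fun t _ => (hRd t).continuousAt.continuousWithinAt)
    (fun t _ => (hRd t).hasDerivWithinAt)
    (by simp [hq, hP0 ε hεδ, hQ00, hQ10, hQ20]) hbound
  intro t ht
  refine (hmain t ht).trans ?_
  simp only [gronwallBound_of_K_ne_0 hKpos.ne', sub_zero, zero_mul, zero_add]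
  have : Real.exp (K * t) ≤ Real.exp (K * T) :=
    Real.exp_le_exp.2 (mul_le_mul_of_nonneg_left ht.2 hKpos.le)
  calc D * |ε| ^ 3 / K * (Real.exp (K * t) - 1)
      ≤ D * |ε| ^ 3 / K * (Real.exp (K * T) - 1) :=
        mul_le_mul_of_nonneg_left (by linarith) (by positivity)
    _ = _ := by ring

end Gronwall

end Floquet

/-! ### Scalar Fourier coefficients on `[0, T]` -/

namespace Floquet

open Filter Topology Set MeasureTheory

theorem mode_add (T : ℝ) (m n : ℤ) (t : ℝ) : mode T (m + n) t = mode T m t * mode T n t := by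
  rw [mode, mode, mode, ← Complex.exp_add]
  push_cast
  ring_nf

@[simp] theorem mode_index_zero (T t : ℝ) : mode T 0 t = 1 := by simp [mode]

@[simp] theorem mode_time_zero (T : ℝ) (m : ℤ) : mode T m 0 = 1 := by simp [mode]

theorem freq_mul_period {T : ℝ} (hT : 0 < T) : freq T * T = 2 * Real.pi * Complex.I := by
  have : (T : ℂ) ≠ 0 := by exact_mod_cast hT.ne'
  rw [freq]
  field_simp

theorem freq_ne_zero {T : ℝ} (hT : 0 < T) : freq T ≠ 0 := by
  intro h
  have := freq_mul_period hT
  rw [h, zero_mul] at this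
  exact Complex.two_pi_I_ne_zero this.symm

theorem mode_period {T : ℝ} (hT : 0 < T) (m : ℤ) : mode T m T = 1 := by
  rw [mode, mul_right_comm, freq_mul_period hT, mul_comm]
  exact Complex.exp_int_mul_two_pi_mul_I m

theorem hasDerivAt_mode (T : ℝ) (m : ℤ) (t : ℝ) :
    HasDerivAt (mode T m) (freq T * m * mode T m t) t := by
  have h : HasDerivAt (fun s : ℝ => freq T * (m : ℂ) * (s : ℂ)) (freq T * m) t := by
    simpa using (Complex.ofRealCLM.hasDerivAt (x := t)).const_mul (freq T * (m : ℂ))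
  rw [mul_comm]
  exact h.cexp

@[fun_prop] theorem continuous_mode (T : ℝ) (m : ℤ) : Continuous (mode T m) :=
  continuous_iff_continuousAt.2 fun t => (hasDerivAt_mode T m t).continuousAt

/-- The `m`-th Fourier coefficient of a scalar function on `[0, T]`. -/
noncomputable def coeff (T : ℝ) (f : ℝ → ℂ) (m : ℤ) : ℂ :=
  (1 / (T : ℂ)) * ∫ t in (0 : ℝ)..T, mode T (-m) t * f t

theorem fourierMat_apply {N : ℕ} (T : ℝ) (B : ℝ → Matrix (Fin N) (Fin N) ℂ) (m : ℤ)
    (k l : Fin N) : fourierMat T B m k l = coeff T (fun t => B t k l) m := rfl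

/-- Coefficients see only `[0, T]`, so identifying `P i` with `Q i` on this interval is enough. -/
theorem coeff_congr {T : ℝ} (hT : 0 < T) {f g : ℝ → ℂ} (h : ∀ t ∈ Icc 0 T, f t = g t) (m : ℤ) :
    coeff T f m = coeff T g m := by
  rw [coeff, coeff]
  congr 1
  refine intervalIntegral.integral_congr fun t ht => ?_
  rw [uIcc_of_le hT.le] at ht
  simp only [h t ht]

theorem coeff_add {T : ℝ} {f g : ℝ → ℂ} (hf : Continuous f) (hg : Continuous g) (m : ℤ) :
    coeff T (fun t => f t + g t) m = coeff T f m + coeff T g m := by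
  simp only [coeff, mul_add]
  rw [intervalIntegral.integral_add, mul_add] <;>
    exact Continuous.intervalIntegrable (by fun_prop) _ _

theorem coeff_const_mul (T : ℝ) (c : ℂ) (f : ℝ → ℂ) (m : ℤ) :
    coeff T (fun t => c * f t) m = c * coeff T f m := by
  simp only [coeff, mul_left_comm _ c]
  rw [intervalIntegral.integral_const_mul]
  ring

theorem coeff_sub {T : ℝ} {f g : ℝ → ℂ} (hf : Continuous f) (hg : Continuous g) (m : ℤ) :
    coeff T (fun t => f t - g t) m = coeff T f m - coeff T g m := by
  simp only [coeff, mul_sub]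
  rw [intervalIntegral.integral_sub, mul_sub] <;>
    exact Continuous.intervalIntegrable (by fun_prop) _ _

theorem coeff_sum {ι : Type*} {T : ℝ} (S : Finset ι) {f : ι → ℝ → ℂ}
    (hf : ∀ i ∈ S, Continuous (f i)) (m : ℤ) :
    coeff T (fun t => ∑ i ∈ S, f i t) m = ∑ i ∈ S, coeff T (f i) m := by
  simp only [coeff, Finset.mul_sum]
  rw [intervalIntegral.integral_finsetSum, Finset.mul_sum]
  intro i hi
  have := hf i hi
  exact Continuous.intervalIntegrable (by fun_prop) _ _

theorem coeff_mode_mul (T : ℝ) (s : ℤ) (f : ℝ → ℂ) (m : ℤ) :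
    coeff T (fun t => mode T s t * f t) m = coeff T f (m - s) := by
  simp only [coeff, ← mul_assoc, ← mode_add]
  rw [show -m + s = -(m - s) by ring]

theorem coeff_one {T : ℝ} (hT : 0 < T) (m : ℤ) :
    coeff T (fun _ => 1) m = if m = 0 then 1 else 0 := by
  have hT' : (T : ℂ) ≠ 0 := by exact_mod_cast hT.ne'
  split_ifs with h
  · subst h
    simp [coeff, hT']
  · have hne : freq T * ((-m : ℤ) : ℂ) ≠ 0 :=
      mul_ne_zero (freq_ne_zero hT) (by exact_mod_cast neg_ne_zero.2 h)
    have := intervalIntegral.integral_eq_sub_of_hasDerivAt (a := 0) (b := T)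
      (fun t _ => hasDerivAt_mode T (-m) t)
      (Continuous.intervalIntegrable (by fun_prop) _ _)
    rw [intervalIntegral.integral_const_mul, mode_period hT, mode_time_zero, sub_self] at this
    simp only [coeff, mul_one]
    rw [(mul_eq_zero.1 this).resolve_left hne, mul_zero]

theorem coeff_mode {T : ℝ} (hT : 0 < T) (n m : ℤ) :
    coeff T (mode T n) m = if m = n then 1 else 0 := by
  have := coeff_mode_mul T n (fun _ => 1) m
  simp only [mul_one, coeff_one hT, sub_eq_zero] at this
  exact this

/-- Integration by parts; equal endpoint values make the boundary term vanish, so no periodicity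
beyond `f T = f 0` is needed. -/
theorem coeff_deriv {T : ℝ} (hT : 0 < T) {f f' : ℝ → ℂ} (hf : ∀ t, HasDerivAt f (f' t) t)
    (hf' : Continuous f') (hper : f T = f 0) (m : ℤ) :
    coeff T f' m = freq T * m * coeff T f m := by
  have h := intervalIntegral.integral_mul_deriv_eq_deriv_mul (a := 0) (b := T)
    (fun t _ => hasDerivAt_mode T (-m) t) (fun t _ => hf t)
    (Continuous.intervalIntegrable (by fun_prop) _ _) (hf'.intervalIntegrable _ _)
  rw [mode_period hT, mode_time_zero, hper, sub_self, zero_sub] at h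
  simp only [mul_assoc] at h
  rw [intervalIntegral.integral_const_mul, intervalIntegral.integral_const_mul] at h
  rw [coeff, h, coeff]
  push_cast
  ring

/-- The Fourier series is evaluated at 0 after passing to the circle. It serves to turn `P₁(0) = 0`
into the vanishing of the sum of the coefficients. -/
theorem hasSum_coeff {T : ℝ} (hT : 0 < T) {f : ℝ → ℂ} (hf : Continuous f) (hper : f T = f 0)
    (hs : Summable (coeff T f)) : HasSum (coeff T f) (f 0) := by
  have : Fact (0 < T) := ⟨hT⟩
  have hc : Continuous (AddCircle.liftIco T 0 f) :=
    AddCircle.liftIco_continuous (by rw [zero_add]; exact hper.symm) hf.continuousOn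
  have hcoeff : ∀ m, fourierCoeff (AddCircle.liftIco T 0 f) m = coeff T f m := by
    intro m
    rw [fourierCoeff_eq_intervalIntegral _ _ 0, zero_add, coeff, Complex.real_smul]
    push_cast
    congr 1
    refine intervalIntegral.integral_congr_Ioo_of_le hT.le fun x hx => ?_
    rw [AddCircle.liftIco_coe_apply (by rw [zero_add]; exact Ioo_subset_Ico_self hx),
      fourier_coe_apply, smul_eq_mul, mode, freq]
    congr 2
    push_cast
    ring
  have hfun : fourierCoeff (⟨_, hc⟩ : C(AddCircle T, ℂ)) = coeff T f := funext hcoeff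
  have h := has_pointwise_sum_fourier_series_of_summable (f := ⟨_, hc⟩)
    (by rw [hfun]; exact hs) ((0 : ℝ) : AddCircle T)
  rw [hfun] at h
  have h0 : AddCircle.liftIco T 0 f ((0 : ℝ) : AddCircle T) = f 0 :=
    AddCircle.liftIco_coe_apply (by simpa using hT)
  simp only [ContinuousMap.coe_mk, h0] at h
  simpa using h

end Floquet

/-! ### Linear matrix equations, and bounds for the given families -/

namespace Floquet

open Filter Topology Set MeasureTheory
open scoped Matrix.Norms.Operator

/-- Variation of constants. -/
theorem exists_scalar_solution (a : ℂ) {g : ℝ → ℂ} (hg : Continuous g) :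
    ∃ y : ℝ → ℂ, (∀ t, HasDerivAt y (a * y t + g t) t) ∧ y 0 = 0 := by
  have he : ∀ (b : ℂ) (t : ℝ),
      HasDerivAt (fun s : ℝ => Complex.exp (b * s)) (b * Complex.exp (b * t)) t := by
    intro b t
    have h : HasDerivAt (fun s : ℝ => b * (s : ℂ)) b t := by
      simpa using (Complex.ofRealCLM.hasDerivAt (x := t)).const_mul b
    rw [mul_comm]
    exact h.cexp
  refine ⟨fun t => Complex.exp (a * t) * ∫ s in (0 : ℝ)..t, Complex.exp (-a * s) * g s,
    fun t => ?_, by simp⟩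
  have hi : HasDerivAt (fun t : ℝ => ∫ s in (0 : ℝ)..t, Complex.exp (-a * s) * g s)
      (Complex.exp (-a * t) * g t) t :=
    (show Continuous fun s : ℝ => Complex.exp (-a * s) * g s by fun_prop).integral_hasStrictDerivAt
      0 t |>.hasDerivAt
  convert! (he a t).mul hi using 1
  have : Complex.exp (a * t) * Complex.exp (-a * t) = 1 := by
    rw [← Complex.exp_add, neg_mul, add_neg_cancel, Complex.exp_zero]
  linear_combination (-g t) * this

variable {N : ℕ}

theorem hasDerivAt_matrix {X : ℝ → Matrix (Fin N) (Fin N) ℂ} {X' : Matrix (Fin N) (Fin N) ℂ}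
    {t : ℝ} : HasDerivAt X X' t ↔ ∀ k l, HasDerivAt (fun s => X s k l) (X' k l) t := by
  constructor
  · intro h k l
    let e : Matrix (Fin N) (Fin N) ℂ →L[ℝ] ℂ :=
      LinearMap.toContinuousLinearMap (Matrix.entryLinearMap ℝ ℂ k l)
    exact e.hasFDerivAt.comp_hasDerivAt t h
  · intro h
    have h2 := HasDerivAt.fun_sum (u := Finset.univ) fun k (_ : k ∈ Finset.univ) =>
      HasDerivAt.fun_sum (u := Finset.univ) fun l (_ : l ∈ Finset.univ) =>
        (h k l).smul_const (Matrix.single k l (1 : ℂ))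
    have key : ∀ Y : Matrix (Fin N) (Fin N) ℂ,
        ∑ k, ∑ l, Y k l • Matrix.single k l (1 : ℂ) = Y := by
      intro Y
      conv_rhs => rw [Matrix.matrix_eq_sum_single Y]
      simp [Matrix.smul_single]
    simp only [key] at h2
    exact h2

/-- Diagonality decouples the system: entry `(k,l)` is a scalar equation with rate `(A₀)_kk -
(F₀)_ll`. -/
theorem exists_matrix_solution {A₀ F₀ : Matrix (Fin N) (Fin N) ℂ} (hA : A₀.IsDiag)
    (hF : F₀.IsDiag) {G : ℝ → Matrix (Fin N) (Fin N) ℂ} (hG : Continuous G) :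
    ∃ Q : ℝ → Matrix (Fin N) (Fin N) ℂ,
      (∀ t, HasDerivAt Q (A₀ * Q t - Q t * F₀ + G t) t) ∧ Q 0 = 0 := by
  have hG' : ∀ k l, Continuous fun t => G t k l := fun k l => hG.matrix_elem k l
  choose y hy hy0 using fun k l => exists_scalar_solution (A₀ k k - F₀ l l) (hG' k l)
  refine ⟨fun t => Matrix.of fun k l => y k l t, fun t => ?_, ?_⟩
  · rw [hasDerivAt_matrix]
    intro k l
    convert! hy k l t using 1
    rw [← hA.diagonal_diag, ← hF.diagonal_diag]
    simp only [Matrix.add_apply, Matrix.sub_apply, Matrix.diagonal_mul, Matrix.mul_diagonal,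
      Matrix.of_apply, Matrix.diag_apply, Matrix.diagonal_apply_eq]
    ring
  · ext k l
    simp [hy0]

theorem HasFiniteFourierSeries.continuous {T : ℝ} {B : ℝ → Matrix (Fin N) (Fin N) ℂ}
    (h : HasFiniteFourierSeries T B) : Continuous B := by
  obtain ⟨S, b, hb⟩ := h
  rw [show B = fun t => ∑ m ∈ S, mode T m t • b m from funext hb]
  fun_prop

theorem IsModulatedFamily.continuous {T r₀ : ℝ} {A₀ : Matrix (Fin N) (Fin N) ℂ}
    {A : ℕ → ℝ → Matrix (Fin N) (Fin N) ℂ} {Aeps : ℝ → ℝ → Matrix (Fin N) (Fin N) ℂ}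
    (hA : IsModulatedFamily T r₀ A₀ A Aeps) (i : ℕ) : Continuous (A i) := by
  rcases Nat.eq_zero_or_pos i with rfl | hi
  · rw [show A 0 = fun _ => A₀ from funext hA.const]
    exact continuous_const
  · exact (hA.finite i hi).continuous

/-- Uniform convergence at `ε = ρ` puts consecutive partial sums within distance 2 of each other for
all large indices and all `t`; the finitely many remaining coefficients are bounded by compactness
of `[0, T]`. -/
theorem IsModulatedFamily.exists_coeff_bound {T r₀ ρ : ℝ} {A₀ : Matrix (Fin N) (Fin N) ℂ}
    {A : ℕ → ℝ → Matrix (Fin N) (Fin N) ℂ} {Aeps : ℝ → ℝ → Matrix (Fin N) (Fin N) ℂ}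
    (hA : IsModulatedFamily T r₀ A₀ A Aeps) (hρ : 0 < ρ) (hρr : ρ < r₀) :
    ∃ C, ∀ i, ∀ t ∈ Icc 0 T, ‖A i t‖ ≤ C / ρ ^ i := by
  have hu := hA.series ρ (by rwa [abs_of_pos hρ])
  obtain ⟨M, hM⟩ := eventually_atTop.1 (Metric.tendstoUniformly_iff.1 hu 1 one_pos)
  have hlarge : ∀ i ≥ M, ∀ t, ρ ^ i * ‖A i t‖ ≤ 2 := by
    intro i hi t
    have h1 := hM i hi t
    have h2 := hM (i + 1) (by omega) t
    have h3 := dist_triangle_left (∑ n ∈ Finset.range (i + 1), ((ρ : ℂ) ^ n) • A n t)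
      (∑ n ∈ Finset.range i, ((ρ : ℂ) ^ n) • A n t) (Aeps ρ t)
    rw [dist_eq_norm, Finset.sum_range_succ, add_sub_cancel_left, norm_smul, norm_ofReal_pow,
      abs_of_pos hρ] at h3
    rw [Finset.sum_range_succ] at h2
    linarith
  have hsmall : ∀ i, ∃ c, ∀ t ∈ Icc 0 T, ‖A i t‖ ≤ c := fun i =>
    isCompact_Icc.exists_bound_of_continuousOn (hA.continuous i).continuousOn
  choose c hc using hsmall
  refine ⟨2 + ∑ i ∈ Finset.range M, ρ ^ i * |c i|, fun i t ht => ?_⟩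
  rw [le_div_iff₀ (by positivity), mul_comm]
  have hnn : ∀ i, 0 ≤ ρ ^ i * |c i| := fun i => by positivity
  rcases lt_or_ge i M with h | h
  · have h1 : ρ ^ i * ‖A i t‖ ≤ ρ ^ i * |c i| :=
      mul_le_mul_of_nonneg_left ((hc i t ht).trans (le_abs_self _)) (by positivity)
    have h2 := Finset.single_le_sum (f := fun i => ρ ^ i * |c i|) (fun i _ => hnn i)
      (Finset.mem_range.2 h)
    linarith
  · have := Finset.sum_nonneg fun i (_ : i ∈ Finset.range M) => hnn i
    linarith [hlarge i h t]

theorem IsModulatedFamily.norm_sub_le {T r₀ : ℝ} (hr₀ : 0 < r₀) {A₀ : Matrix (Fin N) (Fin N) ℂ}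
    {A : ℕ → ℝ → Matrix (Fin N) (Fin N) ℂ} {Aeps : ℝ → ℝ → Matrix (Fin N) (Fin N) ℂ}
    (hA : IsModulatedFamily T r₀ A₀ A Aeps) :
    ∃ C δ, 0 < δ ∧ ∀ ε : ℝ, |ε| < δ → ∀ t ∈ Icc 0 T,
      ‖Aeps ε t - (A 0 t + (ε : ℂ) • A 1 t + (ε : ℂ) ^ 2 • A 2 t)‖ ≤ C * |ε| ^ 3 := by
  obtain ⟨C, hC⟩ := hA.exists_coeff_bound (half_pos hr₀) (half_lt_self hr₀)
  refine ⟨2 * C / (r₀ / 2) ^ 3, r₀ / 2 / 2, by positivity, fun ε hε t ht => ?_⟩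
  refine norm_sub_taylor_two_le (half_pos hr₀) (a := fun i => A i t) (fun i => hC i t ht) hε.le ?_
  have hq : |ε| / (r₀ / 2) < 1 := by rw [div_lt_one (half_pos hr₀)]; linarith
  have hs : Summable fun i : ℕ => ((ε : ℂ) ^ i) • A i t :=
    .of_norm_bounded ((summable_geometric_of_lt_one (by positivity) hq).mul_left C)
      (norm_taylor_term_le fun i => hC i t ht)
  have ht2 := (hA.series ε (by linarith)).tendsto_at t
  have h := hs.hasSum
  rwa [tendsto_nhds_unique h.tendsto_sum_nat ht2] at h

theorem exists_taylor_error {E : Type*} [NormedAddCommGroup E] [NormedSpace ℂ E] {r : ℝ}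
    (hr : 0 < r) {a : ℕ → E} {s : ℝ → E}
    (h : ∀ ε : ℝ, |ε| < r → HasSum (fun i : ℕ => ((ε : ℂ) ^ i) • a i) (s ε)) :
    ∃ C δ, 0 < δ ∧ ∀ ε : ℝ, |ε| < δ →
      ‖s ε - (a 0 + (ε : ℂ) • a 1 + (ε : ℂ) ^ 2 • a 2)‖ ≤ C * |ε| ^ 3 := by
  have hρ := half_pos hr
  obtain ⟨C, hC⟩ := Floquet.exists_coeff_bound hρ
    (h (r / 2) (by rw [abs_of_pos hρ]; linarith))
  exact ⟨2 * C / (r / 2) ^ 3, r / 2 / 2, by positivity, fun ε hε =>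
    norm_sub_taylor_two_le hρ hC hε.le (h ε (by linarith))⟩

theorem IsFloquetDecomposition.map_zero {T : ℝ} {A P : ℝ → Matrix (Fin N) (Fin N) ℂ}
    {F : Matrix (Fin N) (Fin N) ℂ} (h : IsFloquetDecomposition T A P F) : P 0 = 1 := by
  simpa using h.fundamental.init

/-- Write `P = X exp(-tF)` and apply the product rule; this also yields the differentiability of
`P`, which is not part of the definition. -/
theorem IsFloquetDecomposition.hasDerivAt {T : ℝ} {A P : ℝ → Matrix (Fin N) (Fin N) ℂ}
    {F : Matrix (Fin N) (Fin N) ℂ} (h : IsFloquetDecomposition T A P F) (t : ℝ) :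
    HasDerivAt P (A t * P t - P t * F) t := by
  have hX : HasDerivAt (fun t : ℝ => P t * NormedSpace.exp ((t : ℂ) • F))
      (A t * (P t * NormedSpace.exp ((t : ℂ) • F))) t :=
    hasDerivAt_matrix.2 (h.fundamental.deriv t)
  have hE : HasDerivAt (fun t : ℝ => NormedSpace.exp (t • (-F)))
      (NormedSpace.exp (t • (-F)) * (-F)) t := hasDerivAt_exp_smul_const (-F) t
  have hinv : ∀ s : ℝ, NormedSpace.exp ((s : ℂ) • F) * NormedSpace.exp (s • (-F)) = 1 := by
    intro s
    rw [Complex.coe_smul, smul_neg]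
    rw [← Matrix.exp_add_of_commute _ _ (Commute.neg_right (Commute.refl (s • F))), add_neg_cancel,
      NormedSpace.exp_zero]
  convert! hX.mul hE using 1
  · funext s
    simp only [Pi.mul_apply, mul_assoc, hinv, mul_one]
  · rw [mul_assoc, mul_assoc (P t), hinv, mul_assoc (P t), ← mul_assoc (NormedSpace.exp _), hinv]
    simp [sub_eq_add_neg]

end Floquet

/-! ### The equations of order zero, one and two -/

namespace Floquet

open Filter Topology Set MeasureTheory
open scoped Matrix.Norms.Operator

variable {N : ℕ}

/-- The `k`-th diagonal entry has rate `(A₀ - F₀)_kk`, which is the frequency of `mode T (n k)`. -/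
theorem IsLeadingExponent.hasDerivAt_diagonal_mode {T : ℝ} {A₀ F₀ : Matrix (Fin N) (Fin N) ℂ}
    {n : Fin N → ℤ} (hF₀ : IsLeadingExponent T A₀ F₀ n) (hA₀ : A₀.IsDiag) (t : ℝ) :
    HasDerivAt (fun t => Matrix.diagonal fun k => mode T (n k) t)
      (A₀ * (Matrix.diagonal fun k => mode T (n k) t)
        - (Matrix.diagonal fun k => mode T (n k) t) * F₀) t := by
  rw [hasDerivAt_matrix]
  intro k l
  rcases eq_or_ne k l with rfl | h
  · have h1 := hF₀.fold k
    simp only [Matrix.sub_apply, Matrix.mul_diagonal, Matrix.diagonal_mul,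
      Matrix.diagonal_apply_eq] at h1 ⊢
    convert! hasDerivAt_mode T (n k) t using 1
    rw [← h1]
    ring
  · simp only [Matrix.sub_apply, Matrix.mul_diagonal, Matrix.diagonal_mul,
      Matrix.diagonal_apply_ne _ h, hA₀ h, hF₀.diag h, zero_mul, mul_zero, sub_self]
    exact hasDerivAt_const t 0

/-- The coefficients of a Floquet decomposition satisfy, up to second order, the equations
obtained from `P' = A P - P F` by comparing powers of `ε`. -/
theorem exists_order_equations {T r₀ : ℝ} (hT : 0 < T) (hr₀ : 0 < r₀)
    {A₀ : Matrix (Fin N) (Fin N) ℂ} {A : ℕ → ℝ → Matrix (Fin N) (Fin N) ℂ}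
    {Aeps : ℝ → ℝ → Matrix (Fin N) (Fin N) ℂ} (hA : IsModulatedFamily T r₀ A₀ A Aeps)
    {F : ℕ → Matrix (Fin N) (Fin N) ℂ} {P : ℕ → ℝ → Matrix (Fin N) (Fin N) ℂ}
    (hFP : IsAnalyticFloquetDecomposition T Aeps F P)
    {n : Fin N → ℤ} (hF₀ : IsLeadingExponent T A₀ (F 0) n) :
    ∃ Q₁ Q₂ : ℝ → Matrix (Fin N) (Fin N) ℂ,
      (∀ t ∈ Icc 0 T, P 0 t = Matrix.diagonal fun k => mode T (n k) t) ∧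
      (∀ t ∈ Icc 0 T, P 1 t = Q₁ t) ∧
      (∀ t, HasDerivAt Q₁ (A₀ * Q₁ t - Q₁ t * F 0
        + (A 1 t * (Matrix.diagonal fun k => mode T (n k) t)
          - (Matrix.diagonal fun k => mode T (n k) t) * F 1)) t) ∧
      (∀ t, HasDerivAt Q₂ (A₀ * Q₂ t - Q₂ t * F 0
        + (A 1 t * Q₁ t + A 2 t * (Matrix.diagonal fun k => mode T (n k) t)
          - (Matrix.diagonal fun k => mode T (n k) t) * F 2 - Q₁ t * F 1)) t) ∧
      Q₁ 0 = 0 ∧ Q₁ T = 0 ∧ Q₂ 0 = 0 ∧ Q₂ T = 0 := by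
  set Q₀ : ℝ → Matrix (Fin N) (Fin N) ℂ := fun t => Matrix.diagonal fun k => mode T (n k) t
    with hQ₀
  have hQ₀d : ∀ t, HasDerivAt Q₀ (A₀ * Q₀ t - Q₀ t * F 0) t :=
    hF₀.hasDerivAt_diagonal_mode hA.diag
  have hQ₀c : Continuous Q₀ := continuous_iff_continuousAt.2 fun t => (hQ₀d t).continuousAt
  have hA1 := hA.continuous 1
  have hA2 := hA.continuous 2
  obtain ⟨Q₁, hQ₁d, hQ₁0⟩ := exists_matrix_solution hA.diag hF₀.diag
    (G := fun t => A 1 t * Q₀ t - Q₀ t * F 1) (by fun_prop)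
  have hQ₁c : Continuous Q₁ := continuous_iff_continuousAt.2 fun t => (hQ₁d t).continuousAt
  obtain ⟨Q₂, hQ₂d, hQ₂0⟩ := exists_matrix_solution hA.diag hF₀.diag
    (G := fun t => A 1 t * Q₁ t + A 2 t * Q₀ t - Q₀ t * F 2 - Q₁ t * F 1) (by fun_prop)
  have hQ₂c : Continuous Q₂ := continuous_iff_continuousAt.2 fun t => (hQ₂d t).continuousAt
  obtain ⟨r, Feps, Peps, hr, hdec⟩ := hFP
  obtain ⟨C₁, δ₁, hδ₁, hAerr⟩ := hA.norm_sub_le hr₀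
  obtain ⟨C₂, δ₂, hδ₂, hFerr⟩ := exists_taylor_error hr fun ε hε => (hdec ε hε).1
  let Q : ℕ → ℝ → Matrix (Fin N) (Fin N) ℂ
    | 0 => Q₀
    | 1 => Q₁
    | _ => Q₂
  have hbA : ∀ i, ∃ c, ∀ t ∈ Icc 0 T, ‖A i t‖ ≤ c := fun i =>
    isCompact_Icc.exists_bound_of_continuousOn (hA.continuous i).continuousOn
  have hbQ : ∀ i, ∃ c, ∀ t ∈ Icc 0 T, ‖Q i t‖ ≤ c := fun i =>
    isCompact_Icc.exists_bound_of_continuousOn (by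
      match i with
      | 0 => exact hQ₀c.continuousOn
      | 1 => exact hQ₁c.continuousOn
      | _ + 2 => exact hQ₂c.continuousOn)
  choose cA hcA using hbA
  choose cQ hcQ using hbQ
  set M : ℝ := ∑ i ∈ Finset.range 3, (|cA i| + |cQ i| + ‖F i‖) with hM
  have hle : ∀ i ≤ 2, |cA i| + |cQ i| + ‖F i‖ ≤ M := fun i hi =>
    Finset.single_le_sum (f := fun i => |cA i| + |cQ i| + ‖F i‖) (fun i _ => by positivity)
      (Finset.mem_range.2 (by omega))
  set δ := min r (min δ₁ δ₂) with hδ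
  have hδpos : 0 < δ := lt_min hr (lt_min hδ₁ hδ₂)
  have hδr : ∀ ε : ℝ, |ε| < δ → |ε| < r ∧ |ε| < δ₁ ∧ |ε| < δ₂ := fun ε h => by
    simpa only [hδ, lt_min_iff] using h
  obtain ⟨C', hC'⟩ := taylor_two_error_le (T := T) (C := max C₁ C₂) (M := M) (δ := δ)
    (A := A) (Q := Q) (F := F) (Aeps := Aeps) (Peps := Peps) (Feps := Feps)
    (fun i hi t ht => (hcA i t ht).trans ((le_abs_self _).trans (by
      linarith [hle i hi, abs_nonneg (cQ i), norm_nonneg (F i)])))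
    (fun i hi t ht => (hcQ i t ht).trans ((le_abs_self _).trans (by
      linarith [hle i hi, abs_nonneg (cA i), norm_nonneg (F i)])))
    (fun i hi => by linarith [hle i hi, abs_nonneg (cA i), abs_nonneg (cQ i)])
    (fun ε hε t ht => (hAerr ε (hδr ε hε).2.1 t ht).trans
      (mul_le_mul_of_nonneg_right (le_max_left _ _) (by positivity)))
    (fun ε hε => (hFerr ε (hδr ε hε).2.2).trans
      (mul_le_mul_of_nonneg_right (le_max_right _ _) (by positivity)))
    (fun ε hε t => (hdec ε (hδr ε hε).1).2.2.hasDerivAt t)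
    (fun ε hε => (hdec ε (hδr ε hε).1).2.2.map_zero)
    (fun t => by rw [hA.const]; exact hQ₀d t)
    (fun t => by
      rw [hA.const]
      convert! hQ₁d t using 1
      simp only [Q]
      abel)
    (fun t => by
      rw [hA.const]
      convert! hQ₂d t using 1
      simp only [Q]
      abel)
    (by simp [Q, hQ₀]) hQ₁0 hQ₂0
  -- Both second-order polynomials approximate `Peps ε t` to `O(ε³)`. The constant `C₃` may depend
  -- on `t`, which is harmless because uniqueness is applied at each fixed `t`.
  have hPQ : ∀ t ∈ Icc 0 T, P 0 t = Q₀ t ∧ P 1 t = Q₁ t ∧ P 2 t = Q₂ t := by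
    intro t ht
    obtain ⟨C₃, δ₃, hδ₃, hPerr⟩ := exists_taylor_error hr fun ε hε => (hdec ε hε).2.1 t
    have := taylor_two_unique (a := P 0 t - Q₀ t) (b := P 1 t - Q₁ t) (c := P 2 t - Q₂ t)
      (C := C' + C₃) (lt_min (lt_min hδpos one_pos) hδ₃) (fun ε hε => by
        have h1 := hC' ε (hε.trans_le (min_le_left _ _)) t ht
        have h2 := hPerr ε (hε.trans_le (min_le_right _ _))
        have h3 := norm_sub_le
          (Peps ε t - (Q₀ t + (ε : ℂ) • Q₁ t + (ε : ℂ) ^ 2 • Q₂ t))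
          (Peps ε t - (P 0 t + (ε : ℂ) • P 1 t + (ε : ℂ) ^ 2 • P 2 t))
        rw [add_mul]
        refine le_trans (le_of_eq ?_) (h3.trans (add_le_add h1 h2))
        congr 1
        module)
    simpa only [sub_eq_zero] using this
  -- Periodicity of `Peps` passes to the coefficients by uniqueness again; it gives the endpoint
  -- values of `Q₁` and `Q₂` at `T`.
  have hper : ∀ i ≤ 2, P i T = P i 0 := by
    obtain ⟨C₃, δ₃, hδ₃, h₃⟩ := exists_taylor_error hr fun ε hε => (hdec ε hε).2.1 T
    obtain ⟨C₄, δ₄, hδ₄, h₄⟩ := exists_taylor_error hr fun ε hε => (hdec ε hε).2.1 0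
    have := taylor_two_unique (a := P 0 T - P 0 0) (b := P 1 T - P 1 0) (c := P 2 T - P 2 0)
      (C := C₃ + C₄) (lt_min hr (lt_min hδ₃ hδ₄)) (fun ε hε => by
        simp only [lt_min_iff] at hε
        have h1 := h₃ ε hε.2.1
        have h2 := h₄ ε hε.2.2
        have hp : Peps ε T = Peps ε 0 := by
          simpa using (hdec ε hε.1).2.2.periodic 0
        rw [hp] at h1
        have h3 := norm_sub_le
          (Peps ε 0 - (P 0 0 + (ε : ℂ) • P 1 0 + (ε : ℂ) ^ 2 • P 2 0))
          (Peps ε 0 - (P 0 T + (ε : ℂ) • P 1 T + (ε : ℂ) ^ 2 • P 2 T))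
        rw [add_mul, add_comm (C₃ * _)]
        refine le_trans (le_of_eq ?_) (h3.trans (add_le_add h2 h1))
        congr 1
        module)
    simp only [sub_eq_zero] at this
    intro i hi
    interval_cases i
    exacts [this.1, this.2.1, this.2.2]
  have h0 : (0 : ℝ) ∈ Icc 0 T := ⟨le_rfl, hT.le⟩
  have hTT : T ∈ Icc 0 T := ⟨hT.le, le_rfl⟩
  refine ⟨Q₁, Q₂, fun t ht => (hPQ t ht).1, fun t ht => (hPQ t ht).2.1, hQ₁d, hQ₂d, hQ₁0, ?_,
    hQ₂0, ?_⟩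
  · rw [← (hPQ T hTT).2.1, hper 1 (by norm_num), (hPQ 0 h0).2.1, hQ₁0]
  · rw [← (hPQ T hTT).2.2, hper 2 (by norm_num), (hPQ 0 h0).2.2, hQ₂0]

end Floquet

/-! ### Fourier form of the order equations -/

namespace Floquet

open Set

theorem tsum_subtype_ne {f g : ℤ → ℂ} {c : ℤ} (hc : g c = 0) (h : ∀ m ≠ c, f m = g m) :
    ∑' m : {m : ℤ // m ≠ c}, f m = ∑' m, g m := by
  rw [show (∑' m : {m : ℤ // m ≠ c}, f m) = ∑' m, {m : ℤ | m ≠ c}.indicator f m from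
    tsum_subtype {m : ℤ | m ≠ c} f]
  refine tsum_congr fun m => ?_
  rcases eq_or_ne m c with rfl | hm
  · simp [hc]
  · simp [indicator, hm, h m hm]

/-- Because `p` sums to zero, `g` may be replaced by `g - g u`. This kills the term at `u`, the only
index where `hrel` does not determine `p`; the shift by `v` then matches the indexing of `hrel`. -/
theorem tsum_mul_of_tsum_eq_zero {p a d : ℤ → ℂ} {u v : ℤ} (hp : p.support.Finite)
    (hsum : ∑' m, p m = 0) (hd : ∀ m ≠ u - v, d m ≠ 0)
    (hrel : ∀ m ≠ u - v, d m * p (m + v) = a m) (g : ℤ → ℂ) :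
    ∑' m, g m * p m = ∑' m : {m : ℤ // m ≠ u - v}, (g (m + v) - g u) * a m / d m := by
  rw [tsum_subtype_ne (f := fun m => (g (m + v) - g u) * a m / d m)
    (g := fun m => (g (m + v) - g u) * p (m + v)) (by simp)
    (fun m hm => by rw [← hrel m hm]; field_simp [hd m hm])]
  refine Eq.trans ?_ ((Equiv.addRight v).tsum_eq fun m => (g m - g u) * p m).symm
  have h1 : Summable fun m => g m * p m :=
    summable_of_hasFiniteSupport (hp.subset fun m hm => by
      simp only [Function.mem_support, ne_eq, mul_eq_zero, not_or] at hm ⊢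
      exact hm.2)
  have h2 : Summable p := summable_of_hasFiniteSupport hp
  simp only [sub_mul]
  rw [h1.tsum_sub (h2.mul_left _), tsum_mul_left, hsum, mul_zero, sub_zero]

variable {N : ℕ} {T : ℝ}

theorem HasFiniteFourierSeries.eq_sum (hT : 0 < T) {B : ℝ → Matrix (Fin N) (Fin N) ℂ}
    (h : HasFiniteFourierSeries T B) :
    ∃ S : Finset ℤ, (∀ m ∉ S, fourierMat T B m = 0) ∧
      ∀ t, B t = ∑ m ∈ S, mode T m t • fourierMat T B m := by
  obtain ⟨S, b, hb⟩ := h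
  have hc : ∀ m, fourierMat T B m = if m ∈ S then b m else 0 := by
    intro m
    ext k l
    rw [fourierMat_apply]
    have : (fun t => B t k l) = fun t => ∑ s ∈ S, b s k l * mode T s t := by
      funext t
      rw [hb t, Matrix.sum_apply]
      exact Finset.sum_congr rfl fun s _ => by rw [Matrix.smul_apply, smul_eq_mul, mul_comm]
    rw [this, coeff_sum S (fun s _ => by fun_prop)]
    simp only [coeff_const_mul]
    simp only [coeff_mode hT, mul_ite, mul_one, mul_zero, Finset.sum_ite_eq]
    split_ifs <;> rfl
  refine ⟨S, fun m hm => by rw [hc, if_neg hm], fun t => ?_⟩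
  rw [hb t]
  exact Finset.sum_congr rfl fun m hm => by rw [hc, if_pos hm]

theorem coeff_entry_mul {B : ℝ → Matrix (Fin N) (Fin N) ℂ} {S : Finset ℤ}
    (hB : ∀ t, B t = ∑ m ∈ S, mode T m t • fourierMat T B m) {f : ℝ → ℂ} (hf : Continuous f)
    (k j : Fin N) (m : ℤ) :
    coeff T (fun t => B t k j * f t) m = ∑ s ∈ S, fourierMat T B s k j * coeff T f (m - s) := by
  have : (fun t => B t k j * f t)
      = fun t => ∑ s ∈ S, fourierMat T B s k j * (mode T s t * f t) := by
    funext t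
    conv_lhs => rw [hB t, Matrix.sum_apply, Finset.sum_mul]
    exact Finset.sum_congr rfl fun s _ => by rw [Matrix.smul_apply, smul_eq_mul]; ring
  rw [this, coeff_sum S (fun s _ => by fun_prop)]
  exact Finset.sum_congr rfl fun s _ => by rw [coeff_const_mul, coeff_mode_mul]

theorem tsum_matrix_apply {f : ℤ → Matrix (Fin N) (Fin N) ℂ} {S : Finset ℤ}
    (hf : ∀ m ∉ S, f m = 0) (k l : Fin N) : (∑' m, f m) k l = ∑' m, f m k l := by
  rw [tsum_eq_sum hf, tsum_eq_sum (s := S) (fun m hm => by rw [hf m hm]; rfl), Matrix.sum_apply]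

theorem IsLeadingExponent.entry_eq {A₀ F₀ : Matrix (Fin N) (Fin N) ℂ} {n : Fin N → ℤ}
    (h : IsLeadingExponent T A₀ F₀ n) (k : Fin N) : A₀ k k = F₀ k k + freq T * n k := by
  have := h.fold k
  rw [Matrix.sub_apply] at this
  linear_combination this

theorem freq_mul_im (T : ℝ) (m : ℤ) : (freq T * m).im = 2 * (Real.pi / T) * m := by
  have : freq T * m = ((2 * (Real.pi / T) * m : ℝ) : ℂ) * Complex.I := by
    rw [freq]
    push_cast
    ring
  rw [this, Complex.im_ofReal_mul, Complex.I_im, mul_one]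

/-- A zero denominator would make `(F₀)_jj - (F₀)_ll` an integer multiple of `2πi/T`. Both imaginary
parts lie in a half-open interval of length `2π/T`, so the integer is 0, which forces `m = n j - n
l` and `(F₀)_jj = (F₀)_ll` together. -/
theorem IsLeadingExponent.denom_ne_zero (hT : 0 < T) {A₀ F₀ : Matrix (Fin N) (Fin N) ℂ}
    {n : Fin N → ℤ} (h : IsLeadingExponent T A₀ F₀ n) (j l : Fin N) {m : ℤ}
    (hm : m ≠ n j - n l ∨ F₀ j j ≠ F₀ l l) : freq T * m + A₀ l l - A₀ j j ≠ 0 := by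
  intro h0
  rw [h.entry_eq, h.entry_eq] at h0
  have h1 : freq T * ((m + n l - n j : ℤ) : ℂ) = F₀ j j - F₀ l l := by
    push_cast
    linear_combination h0
  have h2 : m + n l - n j = 0 := by
    have him := congrArg Complex.im h1
    rw [freq_mul_im, Complex.sub_im] at him
    have hj := h.im_mem j
    have hl := h.im_mem l
    have hpos : 0 < Real.pi / T := div_pos Real.pi_pos hT
    have hlt : ((m + n l - n j : ℤ) : ℝ) < 1 := by
      by_contra hcon
      push Not at hcon
      nlinarith [hj.2, hl.1]
    have hgt : (-1 : ℝ) < ((m + n l - n j : ℤ) : ℝ) := by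
      by_contra hcon
      push Not at hcon
      nlinarith [hj.1, hl.2]
    have h3 : m + n l - n j < 1 := by exact_mod_cast hlt
    have h4 : -1 < m + n l - n j := by exact_mod_cast hgt
    omega
  rw [h2] at h1
  rcases hm with hm | hm
  · omega
  · apply hm
    rw [Int.cast_zero, mul_zero] at h1
    exact (sub_eq_zero.1 h1.symm)

section Relations

variable {r₀ : ℝ} {A₀ : Matrix (Fin N) (Fin N) ℂ} {A : ℕ → ℝ → Matrix (Fin N) (Fin N) ℂ}
  {Aeps : ℝ → ℝ → Matrix (Fin N) (Fin N) ℂ} {F : ℕ → Matrix (Fin N) (Fin N) ℂ}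
  {P : ℕ → ℝ → Matrix (Fin N) (Fin N) ℂ} {n : Fin N → ℤ}

/-- The Fourier coefficients of the first order equation. -/
theorem first_order_relations (hT : 0 < T) (hr₀ : 0 < r₀)
    (hA : IsModulatedFamily T r₀ A₀ A Aeps) (hFP : IsAnalyticFloquetDecomposition T Aeps F P)
    (hF₀ : IsLeadingExponent T A₀ (F 0) n) :
    (∀ m, fourierMat T (P 0) m = Matrix.diagonal fun k => if m = n k then 1 else 0) ∧
    (∀ m j l, (freq T * m + A₀ l l - A₀ j j) * fourierMat T (P 1) (m + n l) j l
      = fourierMat T (A 1) m j l - if m = n j - n l then F 1 j l else 0) ∧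
    (∀ j l, (fun m => fourierMat T (P 1) m j l).support.Finite) ∧
    (∀ j l, ∑' m, fourierMat T (P 1) m j l = 0) ∧
    (∀ k l, F 0 k k = F 0 l l → F 2 k l =
      (∑ j, ∑' m, fourierMat T (A 1) (n k - m) k j * fourierMat T (P 1) m j l)
      - (fourierMat T (P 1) (n k) * F 1) k l + fourierMat T (A 2) (n k - n l) k l) := by
  obtain ⟨Q₁, Q₂, hP0, hP1, hQ₁, hQ₂, hQ₁0, hQ₁T, hQ₂0, hQ₂T⟩ :=
    exists_order_equations hT hr₀ hA hFP hF₀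
  have hA1c : Continuous (A 1) := hA.continuous 1
  have hA2c : Continuous (A 2) := hA.continuous 2
  have hA1e : ∀ k j, Continuous fun t => A 1 t k j := fun k j => hA1c.matrix_elem k j
  have hA2e : ∀ k j, Continuous fun t => A 2 t k j := fun k j => hA2c.matrix_elem k j
  have hQ₁e : ∀ k j, Continuous fun t => Q₁ t k j := fun k j =>
    continuous_iff_continuousAt.2 fun t => (hasDerivAt_matrix.1 (hQ₁ t) k j).continuousAt
  have hQ₂e : ∀ k j, Continuous fun t => Q₂ t k j := fun k j =>
    continuous_iff_continuousAt.2 fun t => (hasDerivAt_matrix.1 (hQ₂ t) k j).continuousAt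
  have hp1 : ∀ m j l, fourierMat T (P 1) m j l = coeff T (fun t => Q₁ t j l) m := fun m j l =>
    coeff_congr hT (fun t ht => by rw [hP1 t ht]) m
  have hAmode : ∀ (i : ℕ) (k l : Fin N) (m : ℤ),
      coeff T (fun t => A i t k l * mode T (n l) t) m = fourierMat T (A i) (m - n l) k l := by
    intro i k l m
    simp only [mul_comm (A i _ k l), coeff_mode_mul]
    rfl
  have hmodeF : ∀ (i : ℕ) (k l : Fin N) (m : ℤ),
      coeff T (fun t => mode T (n k) t * F i k l) m = if m = n k then F i k l else 0 := by
    intro i k l m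
    simp only [mul_comm (mode T (n k) _), coeff_const_mul]
    rw [coeff_mode hT, mul_ite, mul_one, mul_zero]
  have hrel : ∀ m j l, (freq T * m + A₀ l l - A₀ j j) * fourierMat T (P 1) (m + n l) j l
      = fourierMat T (A 1) m j l - if m = n j - n l then F 1 j l else 0 := by
    intro m j l
    have hd : ∀ t, HasDerivAt (fun t => Q₁ t j l)
        ((A₀ j j - F 0 l l) * Q₁ t j l
          + (A 1 t j l * mode T (n l) t - mode T (n j) t * F 1 j l)) t := by
      intro t
      convert! hasDerivAt_matrix.1 (hQ₁ t) j l using 1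
      rw [← hA.diag.diagonal_diag, ← hF₀.diag.diagonal_diag]
      simp only [Matrix.add_apply, Matrix.sub_apply, Matrix.diagonal_mul, Matrix.mul_diagonal,
        Matrix.diag_apply, Matrix.diagonal_apply_eq]
      ring
    -- The factor `mode T (n l)` coming from `P₀` shifts indices by `n l`; at `m + n l` the
    -- coefficient of `A 1` has index `m`, and `F 0 l l + freq T * n l` recombines to `A₀ l l`.
    have h := coeff_deriv hT hd (by fun_prop) (by rw [hQ₁0, hQ₁T]) (m + n l)
    rw [coeff_add (by fun_prop) (by fun_prop), coeff_const_mul,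
      coeff_sub (by fun_prop) (by fun_prop), hAmode, hmodeF, add_sub_cancel_right, ← hp1] at h
    simp only [eq_sub_iff_add_eq]
    have hl := hF₀.entry_eq l
    push_cast at h
    linear_combination -h + fourierMat T (P 1) (m + n l) j l * hl
  obtain ⟨S, hS0, hS⟩ := (hA.finite 1 le_rfl).eq_sum hT
  have hsupp : ∀ j l, (fun m => fourierMat T (P 1) m j l).support.Finite := by
    intro j l
    refine ((S.finite_toSet.image (· + n l)).insert (n j)).subset fun m hm => ?_
    by_contra hcon
    simp only [mem_insert_iff, mem_image, Finset.mem_coe, not_or, not_exists, not_and] at hcon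
    have h := hrel (m - n l) j l
    rw [hS0 (m - n l) (fun h => hcon.2 _ h (by ring)), if_neg (fun h => hcon.1 (by omega)),
      sub_add_cancel, Matrix.zero_apply, sub_zero] at h
    exact hm ((mul_eq_zero.1 h).resolve_left
      (hF₀.denom_ne_zero hT j l (Or.inl fun h => hcon.1 (by omega))))
  refine ⟨fun m => ?_, hrel, hsupp, fun j l => ?_, fun k l hkl => ?_⟩
  · ext k l
    rw [fourierMat_apply, coeff_congr hT (fun t ht => by rw [hP0 t ht])]
    rcases eq_or_ne k l with rfl | h
    · simp only [Matrix.diagonal_apply_eq]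
      exact coeff_mode hT _ _
    · simp [Matrix.diagonal_apply_ne _ h, coeff]
  · have hs : Summable (coeff T fun t => Q₁ t j l) := by
      simp only [hp1] at hsupp
      exact summable_of_hasFiniteSupport (hsupp j l)
    have := (hasSum_coeff hT (hQ₁e j l) (by rw [hQ₁0, hQ₁T]) hs).tsum_eq
    simp only [hp1]
    rw [this, hQ₁0, Matrix.zero_apply]
  · have hd : ∀ t, HasDerivAt (fun t => Q₂ t k l)
        ((A₀ k k - F 0 l l) * Q₂ t k l
          + (∑ j, A 1 t k j * Q₁ t j l + A 2 t k l * mode T (n l) t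
            - mode T (n k) t * F 2 k l - ∑ j, F 1 j l * Q₁ t k j)) t := by
      intro t
      convert! hasDerivAt_matrix.1 (hQ₂ t) k l using 1
      rw [← hA.diag.diagonal_diag, ← hF₀.diag.diagonal_diag]
      simp only [Matrix.add_apply, Matrix.sub_apply, Matrix.diagonal_mul, Matrix.mul_diagonal,
        Matrix.diag_apply, Matrix.diagonal_apply_eq, Matrix.mul_apply (M := A 1 t) (N := Q₁ t),
        Matrix.mul_apply (M := Q₁ t) (N := F 1), mul_comm (F 1 _ _)]
      ring
    -- Index `n k` is the one at which `F 2 k l` survives; there the coefficient of `Q₂` carries the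
    -- factor `F 0 l l - F 0 k k`, zero by `hkl`.
    have h := coeff_deriv hT hd (by fun_prop) (by rw [hQ₂0, hQ₂T]) (n k)
    rw [coeff_add (by fun_prop) (by fun_prop), coeff_const_mul,
      coeff_sub (by fun_prop) (by fun_prop), coeff_sub (by fun_prop) (by fun_prop),
      coeff_add (by fun_prop) (by fun_prop), hAmode, hmodeF, if_pos rfl,
      coeff_sum _ (fun j _ => by fun_prop), coeff_sum _ (fun j _ => by fun_prop)] at h
    simp only [coeff_const_mul, ← hp1] at h
    have hconv : ∀ j, ∑' m, fourierMat T (A 1) (n k - m) k j * fourierMat T (P 1) m j l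
        = coeff T (fun t => A 1 t k j * Q₁ t j l) (n k) := by
      intro j
      rw [coeff_entry_mul hS (hQ₁e j l),
        -- The substitution `m ↦ n k - m` moves the summation index onto `A 1`, whose coefficients
        -- vanish off `S`.
        ← (Equiv.subLeft (n k)).tsum_eq fun m =>
          fourierMat T (A 1) (n k - m) k j * fourierMat T (P 1) m j l]
      simp only [Equiv.subLeft_apply, sub_sub_cancel, hp1]
      exact tsum_eq_sum fun m hm => by rw [hS0 m hm, Matrix.zero_apply, zero_mul]
    simp only [hconv]
    rw [Matrix.mul_apply, Finset.sum_congr rfl fun j _ => mul_comm _ (F 1 j l)]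
    have hk := hF₀.entry_eq k
    linear_combination -h + coeff T (fun t => Q₂ t k l) (n k) * (hk + hkl)

end Relations

end Floquet

/-! ### Explicit first-order data -/

namespace Floquet

variable {N : ℕ} {T : ℝ} {r₀ : ℝ} {A₀ : Matrix (Fin N) (Fin N) ℂ}
  {A : ℕ → ℝ → Matrix (Fin N) (Fin N) ℂ} {Aeps : ℝ → ℝ → Matrix (Fin N) (Fin N) ℂ}
  {F : ℕ → Matrix (Fin N) (Fin N) ℂ} {P : ℕ → ℝ → Matrix (Fin N) (Fin N) ℂ} {n : Fin N → ℤ}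

theorem tsum_mul_fourierMat_one (hT : 0 < T) (hr₀ : 0 < r₀)
    (hA : IsModulatedFamily T r₀ A₀ A Aeps) (hFP : IsAnalyticFloquetDecomposition T Aeps F P)
    (hF₀ : IsLeadingExponent T A₀ (F 0) n) (g : ℤ → ℂ) (j l : Fin N) :
    ∑' m, g m * fourierMat T (P 1) m j l = ∑' m : {m : ℤ // m ≠ n j - n l},
      (g (m + n l) - g (n j)) * fourierMat T (A 1) m j l
        / (freq T * ((m : ℤ) : ℂ) + A₀ l l - A₀ j j) := by
  obtain ⟨-, hrel, hsupp, hsum, -⟩ := first_order_relations hT hr₀ hA hFP hF₀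
  exact tsum_mul_of_tsum_eq_zero (a := fun m => fourierMat T (A 1) m j l)
    (d := fun m => freq T * (m : ℂ) + A₀ l l - A₀ j j) (hsupp j l) (hsum j l)
    (fun m hm => hF₀.denom_ne_zero hT j l (Or.inl hm))
    (fun m hm => by rw [hrel, if_neg hm, sub_zero]) g

/-- Index `n k` is the exceptional one for row `k`, so its coefficient is minus the sum of all the
others. This is the weighted sum with `g` the indicator of `n k`. -/
theorem fourierMat_one_folding (hT : 0 < T) (hr₀ : 0 < r₀)
    (hA : IsModulatedFamily T r₀ A₀ A Aeps) (hFP : IsAnalyticFloquetDecomposition T Aeps F P)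
    (hF₀ : IsLeadingExponent T A₀ (F 0) n) (k j : Fin N) :
    fourierMat T (P 1) (n k) k j = -∑' m : {m : ℤ // m ≠ n k - n j},
      fourierMat T (A 1) m k j / (freq T * ((m : ℤ) : ℂ) + A₀ j j - A₀ k k) := by
  have h := tsum_mul_fourierMat_one hT hr₀ hA hFP hF₀ (fun m => if m = n k then 1 else 0) k j
  simp only [ite_mul, one_mul, zero_mul, tsum_ite_eq, if_true] at h
  rw [h, ← tsum_neg]
  refine tsum_congr fun m => ?_
  rw [if_neg (fun hm => m.2 (by omega))]
  ring

/-- No denominator vanishes here, so the first-order relation can be divided at every index and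
summed. The coefficients of `P₁` add up to zero, leaving only the `F₁` term. -/
theorem first_exponent_of_ne (hT : 0 < T) (hr₀ : 0 < r₀)
    (hA : IsModulatedFamily T r₀ A₀ A Aeps) (hFP : IsAnalyticFloquetDecomposition T Aeps F P)
    (hF₀ : IsLeadingExponent T A₀ (F 0) n) {j l : Fin N} (hjl : F 0 j j ≠ F 0 l l) :
    F 1 j l = (F 0 l l - F 0 j j) * ∑' m : ℤ, fourierMat T (A 1) m j l
      / (freq T * (m : ℂ) + A₀ l l - A₀ j j) := by
  obtain ⟨-, hrel, hsupp, hsum, -⟩ := first_order_relations hT hr₀ hA hFP hF₀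
  have hd : ∀ m : ℤ, freq T * (m : ℂ) + A₀ l l - A₀ j j ≠ 0 := fun m =>
    hF₀.denom_ne_zero hT j l (Or.inr hjl)
  have hterm : ∀ m : ℤ, fourierMat T (A 1) m j l / (freq T * (m : ℂ) + A₀ l l - A₀ j j)
      = fourierMat T (P 1) (m + n l) j l
        + if m = n j - n l then F 1 j l / (F 0 l l - F 0 j j) else 0 := by
    intro m
    have h := hrel m j l
    rw [div_eq_iff (hd m)]
    split_ifs at h ⊢ with hm
    -- At the exceptional index the folding numbers cancel, and the denominator is the difference of
    -- the leading exponents.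
    · have h1 : freq T * (m : ℂ) + A₀ l l - A₀ j j = F 0 l l - F 0 j j := by
        rw [hF₀.entry_eq j, hF₀.entry_eq l, hm]
        push_cast
        ring
      rw [add_mul, mul_comm, h, h1, div_mul_cancel₀ _ (sub_ne_zero.2 hjl.symm), sub_add_cancel]
    · rw [add_zero, mul_comm, h, sub_zero]
  have hs : Summable fun m => fourierMat T (P 1) m j l := summable_of_hasFiniteSupport (hsupp j l)
  have hs' : Summable fun m => fourierMat T (P 1) (m + n l) j l :=
    (Equiv.addRight (n l)).summable_iff.2 hs
  have h0 : ∑' m, fourierMat T (P 1) (m + n l) j l = 0 :=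
    ((Equiv.addRight (n l)).tsum_eq fun m => fourierMat T (P 1) m j l).trans (hsum j l)
  rw [tsum_congr hterm, hs'.tsum_add (hasSum_ite_eq _ _).summable, h0, tsum_ite_eq, zero_add,
    mul_div_cancel₀ _ (sub_ne_zero.2 hjl.symm)]

/-- The exceptional relation is resonant: its left side has factor zero, so its right side must
vanish. -/
theorem first_exponent_of_eq (hT : 0 < T) (hr₀ : 0 < r₀)
    (hA : IsModulatedFamily T r₀ A₀ A Aeps) (hFP : IsAnalyticFloquetDecomposition T Aeps F P)
    (hF₀ : IsLeadingExponent T A₀ (F 0) n) {j l : Fin N} (hjl : F 0 j j = F 0 l l) :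
    F 1 j l = fourierMat T (A 1) (n j - n l) j l := by
  obtain ⟨-, hrel, -⟩ := first_order_relations hT hr₀ hA hFP hF₀
  have h := hrel (n j - n l) j l
  rw [if_pos rfl, hF₀.entry_eq j, hF₀.entry_eq l, hjl] at h
  push_cast at h
  linear_combination h

end Floquet

/-! ### The second-order exponent formula -/

theorem mainTheorem3 {N : ℕ} (T r₀ : ℝ) (hT : 0 < T) (hr₀ : 0 < r₀)
    (A₀ : Matrix (Fin N) (Fin N) ℂ) (A : ℕ → ℝ → Matrix (Fin N) (Fin N) ℂ)
    (Aeps : ℝ → ℝ → Matrix (Fin N) (Fin N) ℂ)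
    (hA : Floquet.IsModulatedFamily T r₀ A₀ A Aeps)
    (F : ℕ → Matrix (Fin N) (Fin N) ℂ) (P : ℕ → ℝ → Matrix (Fin N) (Fin N) ℂ)
    (hFP : Floquet.IsAnalyticFloquetDecomposition T Aeps F P)
    (n : Fin N → ℤ) (hF₀ : Floquet.IsLeadingExponent T A₀ (F 0) n)
    (k l : Fin N) (hkl : F 0 k k = F 0 l l) :
    -- the second order entry as a sum of three terms
    (F 2 k l =
      (∑' m : ℤ, Floquet.fourierMat T (A 1) (n k - m) * Floquet.fourierMat T (P 1) m) k l
      - (Floquet.fourierMat T (P 1) (n k) * F 1) k l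
      + (∑' m : ℤ, Floquet.fourierMat T (A 2) (n k - m) * Floquet.fourierMat T (P 0) m) k l) ∧
    -- the first term
    ((∑' m : ℤ, Floquet.fourierMat T (A 1) (n k - m) * Floquet.fourierMat T (P 1) m) k l =
      ∑ j : Fin N, ∑' m : {m : ℤ // m ≠ n j - n l},
        (Floquet.fourierMat T (A 1) (n k - n l - m) - Floquet.fourierMat T (A 1) (n k - n j)) k j
          * Floquet.fourierMat T (A 1) m j l
          / (Floquet.freq T * ((m : ℤ) : ℂ) + A₀ l l - A₀ j j)) ∧
    -- the second term, through the first order exponent matrix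
    ((Floquet.fourierMat T (P 1) (n k) * F 1) k l =
      - ∑ j : Fin N, ∑' m : {m : ℤ // m ≠ n k - n j},
        Floquet.fourierMat T (A 1) m k j * F 1 j l
          / (Floquet.freq T * ((m : ℤ) : ℂ) + A₀ j j - A₀ k k)) ∧
    -- the second term, without the first order exponent matrix
    ((Floquet.fourierMat T (P 1) (n k) * F 1) k l =
      - ∑ j : Fin N,
        if F 0 j j = F 0 l l then
          ∑' m : {m : ℤ // m ≠ n k - n j},
            Floquet.fourierMat T (A 1) m k j * Floquet.fourierMat T (A 1) (n j - n l) j l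
              / (Floquet.freq T * ((m : ℤ) : ℂ) + A₀ j j - A₀ k k)
        else
          (F 0 l l - F 0 j j)
            * (∑' m : {m : ℤ // m ≠ n k - n j},
                Floquet.fourierMat T (A 1) m k j
                  / (Floquet.freq T * ((m : ℤ) : ℂ) + A₀ j j - A₀ k k))
            * (∑' m : ℤ, Floquet.fourierMat T (A 1) m j l
                  / (Floquet.freq T * (m : ℂ) + A₀ l l - A₀ j j))) ∧
    -- the third term
    ((∑' m : ℤ, Floquet.fourierMat T (A 2) (n k - m) * Floquet.fourierMat T (P 0) m) k l =
      Floquet.fourierMat T (A 2) (n k - n l) k l) ∧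
    -- the resulting formula
    (F 2 k l =
      (∑ j : Fin N, ∑' m : {m : ℤ // m ≠ n j - n l},
        (Floquet.fourierMat T (A 1) (n k - n l - m) - Floquet.fourierMat T (A 1) (n k - n j)) k j
          * Floquet.fourierMat T (A 1) m j l
          / (Floquet.freq T * ((m : ℤ) : ℂ) + A₀ l l - A₀ j j))
      + (∑ j : Fin N, ∑' m : {m : ℤ // m ≠ n k - n j},
        Floquet.fourierMat T (A 1) m k j * F 1 j l
          / (Floquet.freq T * ((m : ℤ) : ℂ) + A₀ j j - A₀ k k))
      + Floquet.fourierMat T (A 2) (n k - n l) k l) := by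
  obtain ⟨hP0, -, hsupp, -, hF2⟩ := Floquet.first_order_relations hT hr₀ hA hFP hF₀
  obtain ⟨S₁, hS₁, -⟩ := (hA.finite 1 le_rfl).eq_sum hT
  have hfirst : (∑' m : ℤ, Floquet.fourierMat T (A 1) (n k - m) * Floquet.fourierMat T (P 1) m) k l
      = ∑ j, ∑' m, Floquet.fourierMat T (A 1) (n k - m) k j * Floquet.fourierMat T (P 1) m j l := by
    -- Finite support of the matrix series, inherited from `A 1`, permits taking entries inside the
    -- sum.
    rw [Floquet.tsum_matrix_apply (S := S₁.image (n k - ·)) (fun m hm => by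
      rw [hS₁ (n k - m) (fun h => hm (Finset.mem_image.2 ⟨_, h, by ring⟩)), zero_mul])]
    simp only [Matrix.mul_apply]
    exact Summable.tsum_finsetSum fun j _ => summable_of_hasFiniteSupport
      ((hsupp j l).subset fun m hm => by
        simp only [Function.mem_support, ne_eq, mul_eq_zero, not_or] at hm ⊢
        exact hm.2)
  have hfirst' : (∑' m : ℤ, Floquet.fourierMat T (A 1) (n k - m)
        * Floquet.fourierMat T (P 1) m) k l =
      ∑ j : Fin N, ∑' m : {m : ℤ // m ≠ n j - n l},
        (Floquet.fourierMat T (A 1) (n k - n l - m) - Floquet.fourierMat T (A 1) (n k - n j)) k j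
          * Floquet.fourierMat T (A 1) m j l
          / (Floquet.freq T * ((m : ℤ) : ℂ) + A₀ l l - A₀ j j) := by
    rw [hfirst]
    refine Finset.sum_congr rfl fun j _ => ?_
    rw [Floquet.tsum_mul_fourierMat_one hT hr₀ hA hFP hF₀
      (fun m => Floquet.fourierMat T (A 1) (n k - m) k j) j l]
    refine tsum_congr fun m => ?_
    rw [Matrix.sub_apply, show n k - (m + n l) = n k - n l - m by ring]
  have hsecond : (Floquet.fourierMat T (P 1) (n k) * F 1) k l =
      - ∑ j : Fin N, ∑' m : {m : ℤ // m ≠ n k - n j},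
        Floquet.fourierMat T (A 1) m k j * F 1 j l
          / (Floquet.freq T * ((m : ℤ) : ℂ) + A₀ j j - A₀ k k) := by
    rw [Matrix.mul_apply, ← Finset.sum_neg_distrib]
    refine Finset.sum_congr rfl fun j _ => ?_
    rw [Floquet.fourierMat_one_folding hT hr₀ hA hFP hF₀ k j, neg_mul, ← tsum_mul_right]
    exact congrArg _ (tsum_congr fun m => by ring)
  have hthird : (∑' m : ℤ, Floquet.fourierMat T (A 2) (n k - m)
      * Floquet.fourierMat T (P 0) m) k l = Floquet.fourierMat T (A 2) (n k - n l) k l := by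
    obtain ⟨S₂, hS₂, -⟩ := (hA.finite 2 one_le_two).eq_sum hT
    rw [Floquet.tsum_matrix_apply (S := S₂.image (n k - ·)) (fun m hm => by
      rw [hS₂ (n k - m) (fun h => hm (Finset.mem_image.2 ⟨_, h, by ring⟩)), zero_mul])]
    simp only [hP0, Matrix.mul_diagonal]
    rw [tsum_eq_single (n l) (fun m hm => by rw [if_neg hm, mul_zero]), if_pos rfl, mul_one]
  refine ⟨?_, hfirst', hsecond, ?_, hthird, ?_⟩
  · rw [hfirst, hthird]
    exact hF2 k l hkl
  · rw [hsecond]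
    refine congrArg _ (Finset.sum_congr rfl fun j _ => ?_)
    split_ifs with hjl
    · rw [Floquet.first_exponent_of_eq hT hr₀ hA hFP hF₀ hjl]
    · rw [mul_right_comm, ← Floquet.first_exponent_of_ne hT hr₀ hA hFP hF₀ hjl, ← tsum_mul_left]
      exact tsum_congr fun m => by ring
  · rw [hF2 k l hkl, ← hfirst, hfirst', hsecond, sub_neg_eq_add]
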